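/- Let $(R,\mathfrak m)$ be a Noetherian local ring of dimension $d$ that is a normal (i.e. integrally closed) domain, and let $\omega_R\subseteq R$ be a canonical ideal of $R$, that is, an ideal which as an $R$-module is a canonical module: $\mathrm{Hom}_R(\omega_R,E_R(R/\mathfrak m))\cong H^d_{\mathfrak m}(R)$, where $E_R(R/\mathfrak m)$ is the injective hull of the residue field. Let $a\in\mathfrak m$ have no square root in $\mathrm{Frac}(R)$. Let $R(a^{1/2})$ denote the $R$-module $R\oplus R$ with the ring structure $$(r,s)(r',s')=(rr'+ss'a,\; rs'+r's),$$ and let $R\oplus\omega_R=\{(r,x): r\in R,\ x\in\omega_R\}$, which is a subring of $R(a^{1/2})$. Call a Noetherian local ring a complete intersection if its completion is isomorphic to a quotient of a regular local ring by an ideal generated by a regular sequence. Then: (i) for every prime ideal $\mathfrak p$ of $R(a^{1/2})$ of height at most $1$, the local ring $R(a^{1/2})_{\mathfrak p}$ is a complete intersection; (ii) for every prime ideal $\mathfrak p'$ of $R\oplus\omega_R$ of height at most $1$, the local ring $(R\oplus\omega_R)_{\mathfrak p'}$ is a complete intersection. -/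

import Mathlib

open IsLocalRing

universe u

/-- `R(a^{1/2})`: the free module `R ⊕ R` with the multiplication
`(r, s) * (r', s') = (r r' + s s' a, r s' + r' s)`.  The pair `(r, s)` is `⟨r, s⟩`, its
coordinates are `re` and `im`. -/
abbrev SqrtExtension (R : Type u) [CommRing R] (a : R) : Type u :=
  QuadraticAlgebra R a 0

/-- The multiplication rule of `R(a^{1/2})`. -/
theorem SqrtExtension.mk_mul_mk {R : Type u} [CommRing R] (a r s r' s' : R) :
    (⟨r, s⟩ : SqrtExtension R a) * ⟨r', s'⟩ = ⟨r * r' + s * s' * a, r * s' + r' * s⟩ := by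
  ext
  · simp; ring
  · simp; ring

/-- For an ideal `I` of `R`, the subring `R ⊕ I = {(r, x) | r ∈ R, x ∈ I}` of `R(a^{1/2})`. -/
def sqrtExtensionSubring {R : Type u} [CommRing R] (a : R) (I : Ideal R) :
    Subring (SqrtExtension R a) where
  carrier := {z | z.im ∈ I}
  mul_mem' {z w} hz hw := by
    have h : (z * w).im = z.re * w.im + w.re * z.im := by simp; ring
    simp only [Set.mem_ofPred_eq] at hz hw ⊢
    rw [h]
    exact I.add_mem (I.mul_mem_left _ hw) (I.mul_mem_left _ hz)
  one_mem' := by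
    change (0 : R) ∈ I
    exact I.zero_mem
  add_mem' {z w} hz hw := by
    simp only [Set.mem_ofPred_eq] at hz hw ⊢
    simpa using I.add_mem hz hw
  zero_mem' := by simp
  neg_mem' {z} hz := by
    simp only [Set.mem_ofPred_eq] at hz ⊢
    simpa using hz

/-- `i : N → E` is an injective hull of the `R`-module `N`: an embedding into an injective
`R`-module that is an essential extension of the image. -/
structure IsInjectiveHull {R : Type u} [CommRing R] {N E : Type u} [AddCommGroup N] [Module R N]
    [AddCommGroup E] [Module R E] (i : N →ₗ[R] E) : Prop where
  injective_module : Module.Injective R E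
  injective_map : Function.Injective i
  essential : ∀ P : Submodule R E, P ≠ ⊥ → P ⊓ LinearMap.range i ≠ ⊥

/-- `M` is a canonical module of the Noetherian local ring `(R, 𝔪)` of dimension `d`: it is
finitely generated, and its Matlis dual `Hom_R(M, E(R/𝔪))` is isomorphic to the top local
cohomology module `H^d_𝔪(R)`.  (By Matlis duality this says that the completion of `M` is
`Hom_R(H^d_𝔪(R), E(R/𝔪))`.)  The injective hull `E(R/𝔪)` is unique up to isomorphism, so any
model of it may be used. -/
def IsCanonicalModule (R : Type u) [CommRing R] [IsLocalRing R]
    (M : Type u) [AddCommGroup M] [Module R M] : Prop :=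
  Module.Finite R M ∧
    ∃ d : ℕ, ringKrullDim R = d ∧
      ∃ (E : Type u) (_ : AddCommGroup E) (_ : Module R E) (i : ResidueField R →ₗ[R] E),
        IsInjectiveHull i ∧
          Nonempty ((M →ₗ[R] E) ≃ₗ[R]
            ((localCohomology (maximalIdeal R) d).obj (ModuleCat.of R R)))

/-- A canonical ideal: an ideal which, as an `R`-module, is a canonical module. -/
def IsCanonicalIdeal {R : Type u} [CommRing R] [IsLocalRing R] (I : Ideal R) : Prop :=
  IsCanonicalModule R I

/-- `A` is a complete intersection local ring: it is Noetherian local, and its completion is the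
quotient of a regular local ring by an ideal generated by a regular sequence. -/
def IsCompleteIntersectionLocalRing (A : Type u) [CommRing A] : Prop :=
  IsNoetherianRing A ∧ ∃ _ : IsLocalRing A,
    ∃ (Q : Type u) (_ : CommRing Q) (_ : IsRegularLocalRing Q) (x : List Q),
      RingTheory.Sequence.IsRegular Q x ∧
        Nonempty ((Q ⧸ Ideal.ofList x) ≃+* AdicCompletion (maximalIdeal A) A)

/-- `B` is locally a complete intersection in codimension `≤ 1`: `B_𝔭` is a complete intersection
for every prime `𝔭` of height at most `1`. -/
def IsLocallyCompleteIntersectionInCodimLEOne (B : Type u) [CommRing B] : Prop :=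
  ∀ (p : Ideal B) [p.IsPrime], p.height ≤ 1 →
    IsCompleteIntersectionLocalRing (Localization.AtPrime p)

/-! Both rings are of the form `B = R ⊕ I`. For `p` of height at most 1, going-down over the normal
domain `R` bounds the height of `q = p ∩ R` by 1, so `R_q` is a field or a DVR and `I R_q` is
generated by one `t ∈ I`. With `τ = (0, t)`, locally at `q` the ring `B` is `R_q[τ]`, i.e.
`R_q[X]/(X² - t²a)`, or `R_q[X]/(X)` if `t = 0`. Hence `B_p` is a regular local ring modulo one
nonzero element (`of_monogenic`, `of_polynomial`). Completion keeps this presentation: it preserves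
regularity, exactness and, by flatness, regular elements (`of_surjective`). -/

namespace AdicCompletion

/-! ### Completion of a quotient by one regular element -/

section MapOfSurjective

variable {S A : Type u} [CommRing S] [CommRing A]

theorem pow_le_comap_pow_of_map_le {φ : S →+* A} {I : Ideal S} {J : Ideal A}
    (h : I.map φ ≤ J) (n : ℕ) : I ^ n ≤ (J ^ n).comap φ :=
  Ideal.map_le_iff_le_comap.1 ((Ideal.map_pow φ I n).trans_le (Ideal.pow_right_mono h n))

theorem factorPow_comp_quotientMap_comp_evalₐ {φ : S →+* A} {I : Ideal S} {J : Ideal A}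
    (h : I.map φ ≤ J) {m n : ℕ} (hle : m ≤ n) :
    (Ideal.Quotient.factorPow J hle).comp
      ((Ideal.quotientMap (J ^ n) φ (pow_le_comap_pow_of_map_le h n)).comp
        (evalₐ I n : AdicCompletion I S →+* S ⧸ I ^ n)) =
      (Ideal.quotientMap (J ^ m) φ (pow_le_comap_pow_of_map_le h m)).comp
        (evalₐ I m : AdicCompletion I S →+* S ⧸ I ^ m) := by
  ext x
  obtain ⟨x, rfl⟩ := mk_surjective I S x
  simp only [RingHom.comp_apply, RingHom.coe_coe, evalₐ_mk, Ideal.quotientMap_mk]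
  change Ideal.Quotient.mk (J ^ m) (φ (x n)) = Ideal.Quotient.mk (J ^ m) (φ (x m))
  rw [Ideal.Quotient.mk_eq_mk_iff_sub_mem, ← map_sub]
  refine pow_le_comap_pow_of_map_le h m ?_
  rw [← Ideal.Quotient.mk_eq_mk_iff_sub_mem]
  exact (Ideal.mk_eq_mk I hle x)

/-- The ring map between adic completions induced by a ring map `φ` with `I.map φ ≤ J`. -/
noncomputable def mapRingHom (φ : S →+* A) (I : Ideal S) (J : Ideal A) (h : I.map φ ≤ J) :
    AdicCompletion I S →+* AdicCompletion J A :=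
  liftRingHom J
    (fun n ↦ (Ideal.quotientMap (J ^ n) φ (pow_le_comap_pow_of_map_le h n)).comp
      (evalₐ I n : AdicCompletion I S →+* S ⧸ I ^ n))
    (factorPow_comp_quotientMap_comp_evalₐ h)

variable {φ : S →+* A} {I : Ideal S} {J : Ideal A}

theorem evalₐ_mapRingHom_mk (h : I.map φ ≤ J) (n : ℕ) (x : AdicCauchySequence I S) :
    evalₐ J n (mapRingHom φ I J h (mk I S x)) = Ideal.Quotient.mk (J ^ n) (φ (x n)) :=
  (evalₐ_liftRingHom J _ (factorPow_comp_quotientMap_comp_evalₐ h) n _).trans (by simp)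

theorem mem_pow_smul_top_iff_of_map_eq [Algebra S A] (hJ : I.map (algebraMap S A) = J) {n : ℕ}
    {z : A} : z ∈ (I ^ n • ⊤ : Submodule S A) ↔ z ∈ J ^ n := by
  rw [Ideal.smul_top_eq_map, Submodule.restrictScalars_mem, Ideal.map_pow, hJ]

/-- The `J`-adic filtration of `A` is its `I`-adic filtration as an `S`-module, so this is
surjectivity of the completion of a surjective linear map. -/
theorem mapRingHom_surjective (hφ : Function.Surjective φ) (hJ : I.map φ = J) :
    Function.Surjective (mapRingHom φ I J hJ.le) := by
  intro y
  obtain ⟨y, rfl⟩ := mk_surjective J A y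
  algebraize [φ]
  have hmem {n : ℕ} {z : A} : z ∈ (I ^ n • ⊤ : Submodule S A) ↔ z ∈ J ^ n :=
    mem_pow_smul_top_iff_of_map_eq hJ
  have hs : Function.Surjective (map I (Algebra.linearMap S A)) := map_surjective I hφ
  obtain ⟨x, hx⟩ := hs (mk I A (AdicCauchySequence.mk I A y fun n ↦ by
    have := y.2 (Nat.le_succ n)
    rw [SModEq.sub_mem] at this ⊢
    rw [hmem]
    simpa using this))
  obtain ⟨x, rfl⟩ := mk_surjective I S x
  refine ⟨mk I S x, ext_evalₐ fun n ↦ ?_⟩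
  rw [evalₐ_mapRingHom_mk, evalₐ_mk, Ideal.Quotient.mk_eq_mk_iff_sub_mem]
  have := congrArg (fun z ↦ z.val n) hx
  simp only [map_mk, mk_apply_coe, Submodule.mkQ_apply, Submodule.Quotient.eq] at this
  exact hmem.1 this

/-- Completing `0 → S → S → A → 0`, whose first map is multiplication by `f`, is exact because `S`
is Noetherian. -/
theorem ker_mapRingHom [IsNoetherianRing S] (hφ : Function.Surjective φ) (hJ : I.map φ = J)
    {f : S} (hf : IsSMulRegular S f) (hker : RingHom.ker φ = Ideal.span {f}) :
    RingHom.ker (mapRingHom φ I J hJ.le) = Ideal.span {algebraMap S (AdicCompletion I S) f} := by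
  algebraize [φ]
  have hmem {n : ℕ} {z : A} : z ∈ (I ^ n • ⊤ : Submodule S A) ↔ z ∈ J ^ n :=
    mem_pow_smul_top_iff_of_map_eq hJ
  have hexact : Function.Exact (LinearMap.lsmul S S f) (Algebra.linearMap S A) := by
    intro x
    change x ∈ RingHom.ker φ ↔ _
    rw [hker, Ideal.mem_span_singleton']
    simp [mul_comm]
  have hex := map_exact (I := I) (f := LinearMap.lsmul S S f) (g := Algebra.linearMap S A)
    hf hexact hφ
  ext x
  have h1 : x ∈ RingHom.ker (mapRingHom φ I J hJ.le) ↔ map I (Algebra.linearMap S A) x = 0 := by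
    obtain ⟨x, rfl⟩ := mk_surjective I S x
    have hn (n : ℕ) : evalₐ J n (mapRingHom φ I J hJ.le (mk I S x)) = 0 ↔
        (map I (Algebra.linearMap S A) (mk I S x)).val n = 0 := by
      rw [evalₐ_mapRingHom_mk, Ideal.Quotient.eq_zero_iff_mem]
      simp only [map_mk, mk_apply_coe, Submodule.mkQ_apply]
      rw [Submodule.Quotient.mk_eq_zero, hmem]
      rfl
    rw [RingHom.mem_ker]
    constructor
    · intro h
      ext n
      exact (hn n).1 (by rw [h, _root_.map_zero])
    · intro h
      refine ext_evalₐ fun n ↦ ?_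
      rw [(hn n).2 (by rw [h]; rfl), _root_.map_zero]
  have h2 (y : AdicCompletion I S) :
      map I (LinearMap.lsmul S S f) y = y * algebraMap S (AdicCompletion I S) f := by
    obtain ⟨y, rfl⟩ := mk_surjective I S y
    refine ext_evalₐ fun n ↦ ?_
    simp [mul_comm]
  rw [h1, hex x, Ideal.mem_span_singleton']
  simp [h2]

end MapOfSurjective

/-- The completion is a quotient of a power series ring in finitely many variables, one for each
generator of `I`. -/
theorem isNoetherianRing {R : Type u} [CommRing R] [IsNoetherianRing R] (I : Ideal R) :
    IsNoetherianRing (AdicCompletion I R) := by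
  obtain ⟨s, hs⟩ := IsNoetherian.noetherian I
  let φ : MvPolynomial s R →+* R := MvPolynomial.eval (fun i ↦ (i : R))
  have hφ : Function.Surjective φ := fun r ↦ ⟨MvPolynomial.C r, by simp [φ]⟩
  have hJ : (MvPolynomial.idealOfVars s R).map φ = I := by
    rw [MvPolynomial.idealOfVars, Ideal.map_span, ← Set.range_comp, ← hs]
    congr 1
    ext x
    simp [φ]
  have := isNoetherianRing_of_ringEquiv _
    (MvPowerSeries.toAdicCompletionAlgEquiv s R).toRingEquiv
  exact isNoetherianRing_of_surjective _ _ _ (mapRingHom_surjective hφ hJ)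

end AdicCompletion

/-- Completion keeps the embedding dimension, and by going-down it does not lower the height of the
maximal ideal. -/
theorem IsRegularLocalRing.adicCompletion (Q : Type u) [CommRing Q] [IsRegularLocalRing Q] :
    IsRegularLocalRing (AdicCompletion (maximalIdeal Q) Q) := by
  have := AdicCompletion.isNoetherianRing (maximalIdeal Q)
  apply IsRegularLocalRing.of_spanFinrank_maximalIdeal_le
  rw [AdicCompletion.spanFinrank_maximalIdeal_eq, IsRegularLocalRing.spanFinrank_maximalIdeal,
    ← maximalIdeal_height_eq_ringKrullDim, ← maximalIdeal_height_eq_ringKrullDim]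
  have : (maximalIdeal (AdicCompletion (maximalIdeal Q) Q)).LiesOver (maximalIdeal Q) :=
    ⟨(IsLocalRing.maximalIdeal_comap _).symm⟩
  rw [Ideal.height_eq_height_add_of_liesOver_of_hasGoingDown (maximalIdeal Q)
    (maximalIdeal (AdicCompletion (maximalIdeal Q) Q))]
  exact WithBot.coe_le_coe.2 le_self_add

/-! ### Hypersurfaces are complete intersections -/

/-- A local ring presented as the quotient of a regular local ring by a single regular element is a
complete intersection. -/
theorem IsCompleteIntersectionLocalRing.of_surjective {Q A : Type u} [CommRing Q]
    [IsRegularLocalRing Q] [CommRing A] [Nontrivial A] (ψ : Q →+* A) (hψ : Function.Surjective ψ)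
    {f : Q} (hf : IsSMulRegular Q f) (hker : RingHom.ker ψ = Ideal.span {f}) :
    IsCompleteIntersectionLocalRing A := by
  have := IsLocalRing.of_surjective' ψ hψ
  have := IsRegularLocalRing.adicCompletion Q
  have hJ : (maximalIdeal Q).map ψ = maximalIdeal A :=
    eq_maximalIdeal (Ideal.IsMaximal.map_of_surjective_of_ker_le hψ
      (le_maximalIdeal (RingHom.ker_ne_top ψ)))
  have hfm : f ∈ maximalIdeal Q :=
    le_maximalIdeal (RingHom.ker_ne_top ψ) (hker ▸ Ideal.mem_span_singleton_self f)
  let C := AdicCompletion (maximalIdeal Q) Q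
  have hreg : RingTheory.Sequence.IsRegular C [algebraMap Q C f] := by
    refine .of_isWeaklyRegular_of_mem_maximalIdeal C ?_ ?_
    · simp only [List.mem_singleton, forall_eq]
      rw [AdicCompletion.maximalIdeal_eq_map]
      exact Ideal.mem_map_of_mem _ hfm
    · exact RingTheory.Sequence.IsWeaklyRegular.of_flat
        ((RingTheory.Sequence.isWeaklyRegular_singleton_iff Q f).2 hf)
  exact ⟨isNoetherianRing_of_surjective _ _ ψ hψ, inferInstance, C, inferInstance, inferInstance,
    [algebraMap Q C f], hreg, ⟨(Ideal.quotEquivOfEq (by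
      rw [Ideal.ofList_singleton, AdicCompletion.ker_mapRingHom hψ hJ hf hker])).trans
      (RingHom.quotientKerEquivOfSurjective (AdicCompletion.mapRingHom_surjective hψ hJ))⟩⟩

/-- Let `D` be a principal ideal domain. If the local ring `A` consists of fractions of elements of
the image of `φ : D[X] → A`, and `ker φ` is generated by `f ≠ 0`, then `A` is a complete
intersection. -/
theorem IsCompleteIntersectionLocalRing.of_polynomial {D A : Type u} [CommRing D] [IsDomain D]
    [IsPrincipalIdealRing D] [CommRing A] [IsLocalRing A] (φ : Polynomial D →+* A)
    {f : Polynomial D} (hf : f ≠ 0) (hker : RingHom.ker φ = Ideal.span {f})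
    (hfrac : ∀ z, ∃ g h, IsUnit (φ h) ∧ z * φ h = φ g) :
    IsCompleteIntersectionLocalRing A := by
  let M := (maximalIdeal A).comap φ
  have hunit (y : M.primeCompl) : IsUnit (φ y) := by
    simpa [M, Ideal.primeCompl] using y.2
  -- Polynomials over a principal ideal domain form a regular ring, so `Q` is regular local.
  let Q := Localization.AtPrime M
  let ψ : Q →+* A := IsLocalization.lift (M := M.primeCompl) hunit
  have hψφ (g) : ψ (algebraMap _ Q g) = φ g := IsLocalization.lift_eq hunit g
  have hψ : Function.Surjective ψ := by
    intro z
    obtain ⟨g, h, hu, hz⟩ := hfrac z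
    have hh : h ∈ M.primeCompl := by simpa [M, Ideal.primeCompl] using hu
    refine ⟨IsLocalization.mk' Q g ⟨h, hh⟩, ?_⟩
    rw [IsLocalization.lift_mk'_spec, ← hz, mul_comm]
  have hinj : Function.Injective (algebraMap (Polynomial D) Q) :=
    IsLocalization.injective Q M.primeCompl_le_nonZeroDivisors
  have : IsDomain Q :=
    IsLocalization.isDomain_of_le_nonZeroDivisors _ M.primeCompl_le_nonZeroDivisors
  have hf' : algebraMap _ Q f ≠ 0 := (map_ne_zero_iff _ hinj).2 hf
  refine .of_surjective ψ hψ (f := algebraMap _ Q f) ?_ ?_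
  · exact IsSMulRegular.of_ne_zero hf'
  · ext x
    obtain ⟨g, s, rfl⟩ := IsLocalization.exists_mk'_eq M.primeCompl x
    rw [RingHom.mem_ker, IsLocalization.lift_mk', Units.mul_left_eq_zero, ← RingHom.mem_ker, hker]
    rw [← Set.image_singleton, ← Ideal.map_span, IsLocalization.mk'_mem_map_algebraMap_iff]
    constructor
    · intro h
      exact ⟨1, one_mem _, by simpa using h⟩
    · rintro ⟨t, ht, h⟩
      rw [← hker, RingHom.mem_ker, map_mul] at h
      rw [← hker, RingHom.mem_ker]
      exact (hunit ⟨t, ht⟩).mul_right_eq_zero.1 h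

/-! ### The domain `R(a^{1/2})` and normality in codimension one -/

/-- If `a` is not a square in the fraction field of `R`, then `R(a^{1/2})` is a domain. -/
theorem SqrtExtension.isDomain {R : Type u} [CommRing R] [IsDomain R] {a : R}
    (hsq : ¬ IsSquare (algebraMap R (FractionRing R) a)) : IsDomain (SqrtExtension R a) := by
  -- A nonzero element of norm zero would exhibit `a` as the square of `re / im`; the norm is
  -- multiplicative, so there are no zero divisors.
  have hnorm (z : SqrtExtension R a) (hz : z ≠ 0) : z.norm ≠ 0 := by
    intro h
    rw [QuadraticAlgebra.norm_def] at h
    have h' : z.re * z.re = a * (z.im * z.im) := by linear_combination h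
    by_cases him : z.im = 0
    · refine hz (QuadraticAlgebra.ext ?_ him)
      simpa [him] using h'
    · have him' : algebraMap R (FractionRing R) z.im ≠ 0 := by simpa using him
      refine hsq ⟨algebraMap R _ z.re / algebraMap R _ z.im, ?_⟩
      have := congrArg (algebraMap R (FractionRing R)) h'
      simp only [map_mul] at this
      field_simp
      linear_combination -this
  have : NoZeroDivisors (SqrtExtension R a) := by
    refine ⟨fun {x y} hxy ↦ ?_⟩
    by_contra! h
    refine mul_ne_zero (hnorm x h.1) (hnorm y h.2) ?_
    rw [← map_mul, hxy, QuadraticAlgebra.norm_zero]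
  exact NoZeroDivisors.to_isDomain _

/-- The localization of a Noetherian normal domain at a prime of height at most one is a principal
ideal ring. -/
theorem Localization.AtPrime.isPrincipalIdealRing_of_height_le_one {R : Type u} [CommRing R]
    [IsDomain R] [IsNoetherianRing R] [IsIntegrallyClosed R] (q : Ideal R) [q.IsPrime]
    (hq : q.height ≤ 1) : IsPrincipalIdealRing (Localization.AtPrime q) := by
  have : IsDomain (Localization.AtPrime q) :=
    IsLocalization.isDomain_of_le_nonZeroDivisors _ q.primeCompl_le_nonZeroDivisors
  have : IsNoetherianRing (Localization.AtPrime q) :=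
    IsLocalization.isNoetherianRing q.primeCompl _ inferInstance
  have hcl : IsIntegrallyClosed (Localization.AtPrime q) :=
    isIntegrallyClosed_of_isLocalization _ q.primeCompl q.primeCompl_le_nonZeroDivisors
  have : Ring.KrullDimLE 1 (Localization.AtPrime q) := by
    rw [Ring.KrullDimLE, Order.krullDimLE_iff]
    change ringKrullDim _ ≤ _
    rw [IsLocalization.AtPrime.ringKrullDim_eq_height q]
    exact_mod_cast hq
  -- This form of the DVR criterion also admits fields, which covers height 0.
  have htfae : IsPrincipalIdealRing (Localization.AtPrime q) ↔
      IsIntegrallyClosed (Localization.AtPrime q) ∧ ∀ P : Ideal (Localization.AtPrime q),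
        P ≠ ⊥ → P.IsPrime → P = maximalIdeal (Localization.AtPrime q) :=
    (tfae_of_isNoetherianRing_of_isLocalRing_of_isDomain (Localization.AtPrime q)).out 0 3
  exact htfae.2 ⟨hcl, fun P hP hP' ↦ eq_maximalIdeal (hP'.isMaximal_of_ne_bot hP)⟩

/-! ### Monogenic extensions -/

section

variable {R B : Type u} [CommRing R] [IsDomain R] [CommRing B] [IsDomain B]
  [Algebra R B]

/-- Let `B` be a domain over `R`, and `p` a prime of `B` lying over `q` such that `R_q` is a
principal ideal ring. If `B` is, locally at `q`, spanned by `1` and `τ`, and `τ` is a root of a monic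
polynomial of minimal degree among its annihilators, then `B_p` is a complete intersection. -/
theorem IsCompleteIntersectionLocalRing.of_monogenic (p : Ideal B) [p.IsPrime]
    [IsPrincipalIdealRing (Localization.AtPrime (p.under R))]
    (τ : B) (hτ : ∀ b : B, ∃ s ∉ p.under R, ∃ r r' : R, s • b = r • 1 + r' • τ)
    (f : Polynomial R) (hf : f.Monic) (hfτ : Polynomial.aeval τ f = 0)
    (hmin : ∀ g : Polynomial R, g.degree < f.degree → Polynomial.aeval τ g = 0 → g = 0) :
    IsCompleteIntersectionLocalRing (Localization.AtPrime p) := by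
  let q := p.under R
  let D := Localization.AtPrime q
  let A := Localization.AtPrime p
  have : IsDomain D :=
    IsLocalization.isDomain_of_le_nonZeroDivisors _ q.primeCompl_le_nonZeroDivisors
  let i : D →+* A := Localization.localRingHom q p (algebraMap R B) rfl
  have hi (r : R) : i (algebraMap R D r) = algebraMap B A (algebraMap R B r) :=
    Localization.localRingHom_to_map q p (algebraMap R B) rfl r
  let φ : Polynomial D →+* A := Polynomial.eval₂RingHom i (algebraMap B A τ)
  have hφ (g : Polynomial R) :
      φ (g.map (algebraMap R D)) = algebraMap B A (Polynomial.aeval τ g) := by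
    simp only [φ, Polynomial.coe_eval₂RingHom, Polynomial.eval₂_map, Polynomial.aeval_def]
    rw [Polynomial.hom_eval₂]
    congr 1
    ext r
    exact hi r
  have hinj : Function.Injective (algebraMap B A) :=
    IsLocalization.injective A p.primeCompl_le_nonZeroDivisors
  have hDunit (s : R) (hs : s ∉ q) : IsUnit (algebraMap R D s) :=
    IsLocalization.map_units (M := q.primeCompl) D ⟨s, hs⟩
  have hinjD : Function.Injective (algebraMap R D) :=
    IsLocalization.injective D q.primeCompl_le_nonZeroDivisors
  have himage (b : B) : ∃ g, φ g = algebraMap B A b := by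
    obtain ⟨s, hs, r, r', h⟩ := hτ b
    obtain ⟨u, hu⟩ := hDunit s hs
    refine ⟨Polynomial.C (↑u⁻¹ : D) *
      (Polynomial.C r + Polynomial.C r' * Polynomial.X).map (algebraMap R D), ?_⟩
    have h1 : φ (Polynomial.C (algebraMap R D s)) = algebraMap B A (algebraMap R B s) := by
      simp [φ, hi]
    have h2 : φ (Polynomial.C (↑u⁻¹ : D)) * φ (Polynomial.C (algebraMap R D s)) = 1 := by
      rw [← map_mul, ← map_mul, ← hu, Units.inv_mul, map_one, map_one]
    rw [map_mul, hφ]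
    have h3 : Polynomial.aeval τ (Polynomial.C r + Polynomial.C r' * Polynomial.X) =
        algebraMap R B s * b := by
      rw [← Algebra.smul_def, h]
      simp [Algebra.smul_def]
    rw [h3, map_mul, ← h1, ← mul_assoc, h2, one_mul]
  refine .of_polynomial φ (f := f.map (algebraMap R D)) (hf.map _).ne_zero ?_ ?_
  · ext g
    rw [Ideal.mem_span_singleton]
    constructor
    · intro hg
      rw [← (Polynomial.modByMonic_eq_zero_iff_dvd (hf.map _))]
      set g' := g %ₘ f.map (algebraMap R D) with hg'
      have hφf : φ (f.map (algebraMap R D)) = 0 := by rw [hφ, hfτ, map_zero]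
      have hg0 : φ g' = 0 := by
        have := congrArg φ (Polynomial.modByMonic_add_div g (f.map (algebraMap R D)))
        rw [map_add, map_mul, hφf, zero_mul, add_zero] at this
        exact this.trans hg
      have hdeg : g'.degree < f.degree := by
        rw [← hf.degree_map (algebraMap R D)]
        exact Polynomial.degree_modByMonic_lt g (hf.map _)
      obtain ⟨s, hsq, hs⟩ := IsLocalization.integerNormalization_spec q.primeCompl g'
      have hs' : (IsLocalization.integerNormalization q.primeCompl g').map (algebraMap R D) =
        Polynomial.C (algebraMap R D s) * g' := by
        rw [hs, Algebra.smul_def]; rfl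
      have h0 := hmin (IsLocalization.integerNormalization q.primeCompl g') (by
        rw [← Polynomial.degree_map_eq_of_injective hinjD, hs',
          Polynomial.degree_C_mul (by simpa using hinjD.ne (fun h ↦ hsq (by simp [h])))]
        exact hdeg) (hinj (by rw [← hφ, hs', map_mul, hg0, mul_zero, map_zero]))
      rw [h0, Polynomial.map_zero] at hs'
      exact ((mul_eq_zero.1 hs'.symm).resolve_left (by
        simpa using hinjD.ne (fun h ↦ hsq (by simp [h]))))
    · rintro ⟨h, rfl⟩
      rw [RingHom.mem_ker, map_mul, hφ, hfτ, map_zero, zero_mul]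
  · intro z
    obtain ⟨b, s, rfl⟩ := IsLocalization.exists_mk'_eq p.primeCompl z
    obtain ⟨g, hg⟩ := himage b
    obtain ⟨h, hh⟩ := himage s
    refine ⟨g, h, ?_, ?_⟩
    · rw [hh]; exact IsLocalization.map_units A s
    · rw [hg, hh]; exact IsLocalization.mk'_spec A b s

end

/-! ### Primes of height at most one in `R ⊕ I` -/

section

variable {R B : Type u} [CommRing R] [IsDomain R] [IsNoetherianRing R] [IsIntegrallyClosed R]
  [CommRing B] [Algebra R B] {a : R}

/-- An `R`-subalgebra of `R(a^{1/2})` of the form `R ⊕ I` is locally a complete intersection in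
codimension at most one. -/
theorem SqrtExtension.isLocallyCompleteIntersectionInCodimLEOne
    (hsq : ¬ IsSquare (algebraMap R (FractionRing R) a)) (I : Ideal R)
    (ι : B →ₐ[R] SqrtExtension R a) (hinj : Function.Injective ι)
    (hrange : ∀ z, z ∈ ι.range ↔ z.im ∈ I) :
    IsLocallyCompleteIntersectionInCodimLEOne B := by
  intro p _ hp
  have := SqrtExtension.isDomain hsq
  have : IsDomain B := hinj.isDomain ι.toRingHom
  have : Algebra.IsIntegral R B := Algebra.IsIntegral.of_injective ι hinj
  have : FaithfulSMul R B := by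
    rw [faithfulSMul_iff_algebraMap_injective]
    intro x y hxy
    have := congrArg (fun b ↦ (ι b).re) hxy
    simpa using this
  let q := p.under R
  have hq : q.height ≤ 1 := by
    have hB : IsNoetherianRing B := by
      have : IsNoetherian R B := isNoetherian_of_injective ι.toLinearMap hinj
      exact isNoetherian_of_tower R this
    rw [Ideal.height_eq_height_add_of_liesOver_of_hasGoingDown q p] at hp
    exact le_self_add.trans hp
  have : IsPrincipalIdealRing (Localization.AtPrime q) :=
    Localization.AtPrime.isPrincipalIdealRing_of_height_le_one q hq
  obtain ⟨t, htI, ht⟩ : ∃ t ∈ I, ∀ x ∈ I, ∃ s ∉ q, ∃ c, s * x = c * t := by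
    let D := Localization.AtPrime q
    obtain ⟨g, hg⟩ := IsPrincipalIdealRing.principal (I.map (algebraMap R D))
    have hgI : g ∈ I.map (algebraMap R D) := hg ▸ Submodule.mem_span_singleton_self g
    -- Clearing the denominator of the generator `g` changes it by a unit of `R_q` and puts it in
    -- `I`.
    obtain ⟨⟨t, s⟩, hts⟩ := (IsLocalization.mem_map_algebraMap_iff q.primeCompl D).1 hgI
    refine ⟨t, t.2, fun x hx ↦ ?_⟩
    have hxg : algebraMap R D x ∈ I.map (algebraMap R D) := Ideal.mem_map_of_mem _ hx
    rw [hg] at hxg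
    obtain ⟨d, hd⟩ := Submodule.mem_span_singleton.1 hxg
    obtain ⟨c, s', rfl⟩ := IsLocalization.exists_mk'_eq q.primeCompl d
    refine ⟨s * s', (s * s').2, c, ?_⟩
    apply IsLocalization.injective D q.primeCompl_le_nonZeroDivisors
    have := IsLocalization.mk'_spec D c s'
    simp only [smul_eq_mul] at hd hts
    rw [map_mul, map_mul, map_mul, ← hd, ← hts, ← this]
    ring
  obtain ⟨τ, hτ⟩ : ∃ τ, ι τ = ⟨0, t⟩ := (hrange ⟨0, t⟩).2 htI
  have hspan : ∀ b : B, ∃ s ∉ q, ∃ r r' : R, s • b = r • 1 + r' • τ := by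
    intro b
    obtain ⟨s, hs, c, hc⟩ := ht _ ((hrange (ι b)).1 ⟨b, rfl⟩)
    refine ⟨s, hs, s * (ι b).re, c, hinj ?_⟩
    rw [map_smul, map_add, map_smul, map_smul, map_one, hτ]
    ext <;> simp [hc, QuadraticAlgebra.re_one, QuadraticAlgebra.im_one]
  open Polynomial in
  -- If `t = 0` then `τ = 0`, and `X`, not `X²`, has minimal degree.
  by_cases ht0 : t = 0
  · subst ht0
    have hτ0 : τ = 0 := hinj (by rw [hτ, map_zero]; rfl)
    refine .of_monogenic p τ hspan X monic_X (by simp [hτ0]) ?_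
    intro g hg hgτ
    rw [degree_X] at hg
    rw [eq_C_of_degree_le_zero (Order.le_of_lt_succ hg)] at hgτ ⊢
    rw [aeval_C, map_eq_zero_iff _ (FaithfulSMul.algebraMap_injective R B)] at hgτ
    rw [hgτ, C_0]
  · have hdeg : (X ^ 2 - C (t ^ 2 * a)).degree = 2 := degree_X_pow_sub_C two_pos _
    refine .of_monogenic p τ hspan (X ^ 2 - C (t ^ 2 * a)) (monic_X_pow_sub_C _ two_ne_zero) ?_ ?_
    · apply hinj
      rw [map_zero, ← aeval_algHom_apply, hτ]
      ext <;> simp [pow_two]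
      ring
    · intro g hg hgτ
      rw [hdeg] at hg
      have hgle : g.degree ≤ 1 := Order.le_of_lt_succ hg
      -- A linear polynomial `c₁X + c₀` takes the value `(c₀, c₁t)` at `τ`, and `t ≠ 0`.
      rw [eq_X_add_C_of_degree_le_one hgle] at hgτ ⊢
      have h := congrArg ι hgτ
      rw [← aeval_algHom_apply, hτ] at h
      have him := congrArg QuadraticAlgebra.im h
      have hre := congrArg QuadraticAlgebra.re h
      have h1 : g.coeff 1 = 0 := by simpa [ht0] using him
      have h0 : g.coeff 0 = 0 := by simpa using hre
      simp [h0, h1]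

end

theorem lemma3p3 {R : Type u} [CommRing R] [IsDomain R] [IsNoetherianRing R] [IsLocalRing R]
    [IsIntegrallyClosed R] (ω : Ideal R) (hω : IsCanonicalIdeal ω)
    (a : R) (ha : a ∈ maximalIdeal R) (hsq : ¬ IsSquare (algebraMap R (FractionRing R) a)) :
    IsLocallyCompleteIntersectionInCodimLEOne (SqrtExtension R a) ∧
      IsLocallyCompleteIntersectionInCodimLEOne (sqrtExtensionSubring a ω) := by
  refine ⟨SqrtExtension.isLocallyCompleteIntersectionInCodimLEOne hsq ⊤ (AlgHom.id R _)
    Function.injective_id (by simp), ?_⟩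
  let B : Subalgebra R (SqrtExtension R a) :=
    { sqrtExtensionSubring a ω with
      algebraMap_mem' := fun r ↦ ω.zero_mem }
  exact SqrtExtension.isLocallyCompleteIntersectionInCodimLEOne (B := B) hsq ω B.val
    Subtype.val_injective (fun z ↦ by rw [Subalgebra.range_val]; rfl)
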